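/- Let $\mathcal H$ be an infinite-dimensional separable complex Hilbert space. For a compact operator $x$ on $\mathcal H$ let $\mu_1(x)\ge\mu_2(x)\ge\dots\ge 0$ be the eigenvalues of $|x|=\sqrt{x^*x}$ in decreasing order, nonzero ones repeated according to multiplicity (followed by zeros if there are only finitely many), and put $$\gamma_n(x)=\frac{1}{\log n}\sum_{j\le n}\mu_j(x)\quad(n\ge 2),\qquad L^{1,\infty}(\mathcal H)=\{x \text{ compact}:\ \sup_{n\ge 2}\gamma_n(x)<\infty\}.$$ Let $L^{1,\infty}(\mathcal H)_+$ be the set of positive elements of $L^{1,\infty}(\mathcal H)$. Let $\Gamma_{s}$ be the set of all states $\omega$ on $\ell^\infty(\mathbb N)$, $\mathbb N=\{1,2,\dots\}$ (positive linear forms of norm one), such that $\omega((f_{2j})_{j})=\omega((f_j)_{j})$ for all $f\in\ell^\infty(\mathbb N)$ and $\omega(f)=\lim_n f_n$ for every convergent sequence $f$. For $\omega\in\Gamma_s$ and $x\in L^{1,\infty}(\mathcal H)_+$ the Dixmier trace is $\mathrm{Tr}_\omega(x)=\omega\big((\gamma_2(x),\gamma_3(x),\dots)\big)$. Let $\mathrm{tr}$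 be the usual trace on the trace-class operators. Let $x\ge 0$ be a compact operator on $\mathcal H$ with $\mu_n(x)=O(1/n)$. Then: 1. $x\in L^{1,\infty}(\mathcal H)_+$; for every $z\in\mathbb C$ with $\operatorname{Re} z>1$ the operator $x^z$ (with $0^z=0$) is of trace class, and $\zeta_x(z)=\mathrm{tr}\,x^z$ is a holomorphic function in the half-plane $\operatorname{Re} z>1$. 2. Suppose that $\zeta_x$ extends to a continuous function on $\{\operatorname{Re} z\ge 1\}\setminus\{1\}$ with at worst a simple pole at $1$, in the sense that $(z-1)\zeta_x(z)$ has a finite limit as $z\to 1$, $\operatorname{Re}z\ge 1$, $z\neq 1$. Then both limits below exist, are finite, and for every $\omega\in\Gamma_s$ $$\mathrm{Tr}_\omega(x)=\lim_{n\to\infty}\gamma_n(x)=\lim_{s\to 1+}(s-1)\,\mathrm{tr}\,x^s .$$ 3. If $\zeta_x$ extends to a meromorphic function $F$ on $\mathbb C$ with at worst a simple pole at $z=1$ (no condition being imposed on other poles), then the formula in 2 holds as well, and for every $\omega\in\Gamma_s$ $$\mathrm{Tr}_\omega(x)=\operatorname{Res}_{z=1}F .$$ -/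

import Mathlib

open Filter Topology Asymptotics
open scoped ENNReal lp InnerProductSpace ComplexOrder

namespace Dixmier

section Operators

variable {H : Type*} [NormedAddCommGroup H] [InnerProductSpace ℂ H] [CompleteSpace H]

/-- The span of all eigenvectors of `|x| = √(x⋆ x)` to eigenvalues `t > l`. Its dimension is the
number of eigenvalues of `|x|` exceeding `l`, counted with multiplicity. -/
noncomputable def eigenspan (x : H →L[ℂ] H) (l : ℝ) : Submodule ℂ H :=
  ⨆ t : Set.Ioi l, Module.End.eigenspace ((CFC.abs x : H →L[ℂ] H) : H →ₗ[ℂ] H) ((t : ℝ) : ℂ)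

/-- The `n`-th characteristic (singular) value `μ_n(x)`, `n = 1, 2, …`, of a compact operator `x`:
the `n`-th largest eigenvalue of `|x|`, nonzero eigenvalues repeated according to multiplicity,
i.e. the least `l ≥ 0` such that fewer than `n` eigenvalues of `|x|` exceed `l`. -/
noncomputable def mu (x : H →L[ℂ] H) (n : ℕ) : ℝ :=
  sInf {l : ℝ | 0 ≤ l ∧ Module.rank ℂ (eigenspan x l) < (n : Cardinal)}

/-- `σ_n(x) = ∑_{j = 1}^n μ_j(x)`. -/
noncomputable def sigma (x : H →L[ℂ] H) (n : ℕ) : ℝ := ∑ j ∈ Finset.Icc 1 n, mu x j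

/-- `γ_n(x) = σ_n(x) / log n`, used for `n ≥ 2`. -/
noncomputable def gamma (x : H →L[ℂ] H) (n : ℕ) : ℝ := sigma x n / Real.log n

variable (H) in
/-- The ideal `L^{1,∞}(H)` of all compact `x` with `sup_{n ≥ 2} γ_n(x) < ∞`. -/
def L1infty : Set (H →L[ℂ] H) :=
  {x | IsCompactOperator x ∧ BddAbove (gamma x '' Set.Ici 2)}

variable (H) in
/-- The positive cone `L^{1,∞}(H)_+`. -/
def L1inftyPos : Set (H →L[ℂ] H) := {x | x ∈ L1infty H ∧ 0 ≤ x}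

/-- Trace-class operators: compact operators with `∑ μ_n(y) < ∞`. -/
def IsTraceClass (y : H →L[ℂ] H) : Prop :=
  IsCompactOperator y ∧ Summable fun n : ℕ => mu y (n + 1)

/-- The usual trace `∑ ⟨y ψ_i, ψ_i⟩` of a trace-class operator `y`, computed in some fixed
orthonormal basis `(ψ_i)` of `H` (inner products are linear in the second variable here). -/
noncomputable def tr (y : H →L[ℂ] H) : ℂ :=
  ∑' i : (exists_hilbertBasis ℂ H).choose, ⟪(i : H), y (i : H)⟫_ℂ

/-- The power `x^z`, `Re z > 0`, of a positive operator `x`, by functional calculus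
(with `0^z = 0`). -/
noncomputable def pow (x : H →L[ℂ] H) (z : ℂ) : H →L[ℂ] H := cfc (fun t : ℂ => t ^ z) x

/-- `ζ_x(z) = tr x^z`. -/
noncomputable def zeta (x : H →L[ℂ] H) (z : ℂ) : ℂ := tr (pow x z)

lemma mu_nonneg (x : H →L[ℂ] H) (n : ℕ) : 0 ≤ mu x n :=
  Real.sInf_nonneg fun _ h => h.1

lemma gamma_nonneg (x : H →L[ℂ] H) (n : ℕ) : 0 ≤ gamma x n :=
  div_nonneg (Finset.sum_nonneg fun j _ => mu_nonneg x j) (Real.log_natCast_nonneg n)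

/-- The bounded sequence `γ(x) = (γ_2(x), γ_3(x), …)`, with `n`-th term `γ_{n+1}(x)`, `n ≥ 1`. -/
noncomputable def gammaSeq (x : H →L[ℂ] H) (hx : x ∈ L1infty H) : ℓ^∞(ℕ+, ℂ) :=
  ⟨fun n => ((gamma x (n + 1) : ℝ) : ℂ), by
    obtain ⟨C, hC⟩ := hx.2
    refine memℓp_infty ⟨C, ?_⟩
    rintro _ ⟨n, rfl⟩
    simp only [Complex.norm_real, Real.norm_eq_abs, abs_of_nonneg (gamma_nonneg x _)]
    exact hC ⟨_, by have := n.pos; simp only [Set.mem_Ici]; omega, rfl⟩⟩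

end Operators

section States

/-- The scaling map `s(f)_j = f_{2j}` on `ℓ^∞`. -/
noncomputable def scaling (f : ℓ^∞(ℕ+, ℂ)) : ℓ^∞(ℕ+, ℂ) :=
  ⟨fun j => f (2 * j), by
    obtain ⟨C, hC⟩ := (lp.memℓp f).bddAbove
    refine memℓp_infty ⟨C, ?_⟩
    rintro _ ⟨n, rfl⟩
    exact hC ⟨_, rfl⟩⟩

/-- The set `Γ_s(ℓ^∞)`: states (positive linear forms of norm one) on `ℓ^∞` that are invariant
under scaling and assign to each convergent sequence its limit. -/
structure IsScalingInvariantState (ω : ℓ^∞(ℕ+, ℂ) →L[ℂ] ℂ) : Prop where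
  pos : ∀ f : ℓ^∞(ℕ+, ℂ), 0 ≤ ω (star f * f)
  norm_eq_one : ‖ω‖ = 1
  scaling_invariant : ∀ f : ℓ^∞(ℕ+, ℂ), ω (scaling f) = ω f
  eq_lim : ∀ (f : ℓ^∞(ℕ+, ℂ)) (a : ℂ), Tendsto (fun n : ℕ+ => f n) atTop (𝓝 a) → ω f = a

/-- The Dixmier trace `Tr_ω(x) = ω(γ(x))` on `L^{1,∞}(H)_+`. -/
noncomputable def dixmierTrace {H : Type*} [NormedAddCommGroup H] [InnerProductSpace ℂ H]
    [CompleteSpace H] (ω : ℓ^∞(ℕ+, ℂ) →L[ℂ] ℂ) (x : H →L[ℂ] H) (hx : x ∈ L1inftyPos H) : ℂ :=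
  ω (gammaSeq x hx.1)

end States

section ComplexAnalysis

/-- `f`, given on `Re z > 1`, extends to a function on `{Re z ≥ 1} \ {1}` that is continuous there
and has at worst a simple pole at `1`: `(z - 1) F(z)` has a finite limit as `z → 1`,
`Re z ≥ 1`, `z ≠ 1`. -/
def ExtendsToClosedHalfPlane (f : ℂ → ℂ) : Prop :=
  ∃ F : ℂ → ℂ, Set.EqOn F f {z | 1 < z.re} ∧ ContinuousOn F ({z | 1 ≤ z.re} \ {1}) ∧
    ∃ L : ℂ, Tendsto (fun z => (z - 1) * F z) (𝓝[{z | 1 ≤ z.re} \ {1}] 1) (𝓝 L)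

/-- `R` is the residue of `F` at the isolated singularity `c`:
`(2πi)⁻¹ ∮_{|z - c| = r} F(z) dz = R` for all small `r > 0`. -/
def HasResidueAt (F : ℂ → ℂ) (c R : ℂ) : Prop :=
  ∀ᶠ r : ℝ in 𝓝[>] 0, (2 * Real.pi * Complex.I)⁻¹ * (∮ z in C(c, r), F z) = R

end ComplexAnalysis

end Dixmier

/-! Diagonalise `x`: a compact positive operator has a Hilbert basis of eigenvectors, on which `pow
x z` acts by the `z`-th powers of the eigenvalues. The rank in the definition of `mu` counts
eigenvalues above a level, so positive eigenvalues and positive characteristic values match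
bijectively (`hasSum_mu_iff`). Hence `zeta x z` is the generalised Dirichlet series `∑ μ_n ^ z`, and
`μ_n = O(1/n)` gives convergence and holomorphy for `Re z > 1`.

Either extension hypothesis yields a limit of `(s - 1) ζ_x(s)` as `s → 1+` along the reals. The rest
is the Hardy–Littlewood Tauberian theorem, by Karamata's method. If `ε ∑ a_n ^ (1 + ε) → L`, then `ε
∑ a_n ^ (1 + ε) g(a_n ^ ε) → L ∫₀¹ g`, for monomials `g` by rescaling `ε`, then for `u⁻¹ 1_{u ≥
1/e}` by squeezing between polynomials. At `ε = 1 / log N` this is the sum of the `a_n ≥ 1/N`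
divided by `log N`, which differs from the logarithmic mean by `O(1 / log N)`. So `γ_n(x)`
converges, and every admissible state returns its limit; at a simple pole that limit is the residue,
by Cauchy's formula. -/

namespace Dixmier

/-! ### Diagonal operators: eigenbases, characteristic values and traces. -/

section Diagonal

universe u

variable {H : Type u} [NormedAddCommGroup H] [InnerProductSpace ℂ H]

theorem hilbertBasis_inner_eq_ite {ι : Type*} (b : HilbertBasis ι ℂ H) [DecidableEq ι] (i j : ι) :
    ⟪b i, b j⟫_ℂ = if i = j then 1 else 0 :=
  orthonormal_iff_ite.1 b.orthonormal i j

theorem hilbertBasis_ext {ι : Type*} (b : HilbertBasis ι ℂ H) {v w : H} (h : ∀ i, ⟪b i, v⟫_ℂ = ⟪b i, w⟫_ℂ) : v = w := by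
  apply b.repr.injective
  ext i
  simp [b.repr_apply_apply, h]

theorem eigenvalue_norm_le {ι : Type*} (b : HilbertBasis ι ℂ H) {y : H →L[ℂ] H} {k : ι → ℂ} (h : ∀ i, y (b i) = k i • b i) (i : ι) :
    ‖k i‖ ≤ ‖y‖ := by
  have := y.le_opNorm (b i)
  rw [h i, norm_smul, b.orthonormal.1 i] at this
  simpa using this

variable [CompleteSpace H]

/-- A compact self-adjoint operator admits a Hilbert basis of eigenvectors. -/
theorem exists_hilbertBasis_eigenvectors {x : H →L[ℂ] H} (hc : IsCompactOperator x)
    (hs : x.IsSymmetric) :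
    ∃ (ι : Type u) (b : HilbertBasis ι ℂ H) (a : ι → ℂ), ∀ i, x (b i) = a i • b i := by
  let E : ℂ → Submodule ℂ H := fun t => Module.End.eigenspace (x : H →ₗ[ℂ] H) t
  have hEc : ∀ t, IsClosed (E t : Set H) := fun t => by
    have h : (E t : Set H) = {v | x v = t • v} := by
      ext v; simp [E]
    rw [h]
    exact isClosed_eq x.continuous (continuous_const_smul t)
  have : ∀ t, CompleteSpace (E t) := fun t => (hEc t).completeSpace_coe
  choose w e he using fun t => exists_hilbertBasis ℂ (E t)
  have horth := hs.orthogonalFamily_eigenspaces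
  have hon := horth.orthonormal_sigma_orthonormal (fun t => (e t).orthonormal)
  -- Orthogonality to `v` is a closed condition, so it passes from the basis of `E t` to all of `E
  -- t`; the spectral theorem then applies.
  have hsp : (Submodule.span ℂ (Set.range fun p : Σ t, w t =>
      (E p.1).subtypeₗᵢ (e p.1 p.2)))ᗮ = ⊥ := by
    rw [← ContinuousLinearMap.orthogonalComplement_iSup_eigenspaces_eq_bot hc hs]
    refine le_antisymm ?_ (Submodule.orthogonal_le ?_)
    · intro v hv
      rw [← Submodule.iInf_orthogonal, Submodule.mem_iInf]
      intro t
      rw [Submodule.mem_orthogonal]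
      intro y hy
      have hd := (e t).dense_span
      have hy' : (⟨y, hy⟩ : E t) ∈ (Submodule.span ℂ (Set.range (e t))).topologicalClosure := by
        rw [hd]; trivial
      have hcl : IsClosed {z : E t | ⟪(z : H), v⟫_ℂ = 0} :=
        isClosed_eq (by fun_prop) continuous_const
      have hsub : ((Submodule.span ℂ (Set.range (e t)) : Submodule ℂ (E t)) : Set (E t)) ⊆
          {z : E t | ⟪(z : H), v⟫_ℂ = 0} := by
        intro z hz
        induction hz using Submodule.span_induction with
        | mem z hz =>
          obtain ⟨i, rfl⟩ := hz
          exact (Submodule.mem_orthogonal _ _).1 hv _ (Submodule.subset_span ⟨⟨t, i⟩, rfl⟩)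
        | zero => simp
        | add z z' _ _ h h' =>
          simp only [Set.mem_ofPred_eq] at h h' ⊢
          simp [h, h']
        | smul c z _ h =>
          simp only [Set.mem_ofPred_eq] at h ⊢
          simp [h]
      exact closure_minimal hsub hcl hy'
    · refine Submodule.span_le.2 ?_
      rintro _ ⟨p, rfl⟩
      exact Submodule.mem_iSup_of_mem (p := fun t => Module.End.eigenspace (x : H →ₗ[ℂ] H) t)
        p.1 (e p.1 p.2).2
  refine ⟨Σ t, w t, HilbertBasis.mkOfOrthogonalEqBot hon hsp, fun p => p.1, fun p => ?_⟩
  rw [HilbertBasis.coe_mkOfOrthogonalEqBot]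
  exact Module.End.mem_eigenspace_iff.1 (e p.1 p.2).2

/-- The functional calculus acts on eigenvectors by evaluation at the eigenvalue. -/
theorem cfc_apply_eigenvector {x : H →L[ℂ] H} (hx : IsSelfAdjoint x) {v : H} (hv : v ≠ 0) {a : ℂ}
    (h : x v = a • v) {g : ℂ → ℂ} (hg : ContinuousOn g (spectrum ℂ x)) :
    cfc g x v = g a • v := by
  have hn : IsStarNormal x := hx.isStarNormal
  have ha : a ∈ spectrum ℂ x := by
    rw [spectrum.mem_iff]
    intro hu
    obtain ⟨u, hu⟩ := hu
    have h0 : (u : H →L[ℂ] H) v = 0 := by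
      rw [hu]; simp [h, Algebra.algebraMap_eq_smul_one]
    apply hv
    have : ((u⁻¹ : (H →L[ℂ] H)ˣ) * u : H →L[ℂ] H) v = 0 := by
      rw [mul_apply_eq_comp, h0, map_zero]
    simpa using this
  -- Needed in the `star_id` case of the Stone–Weierstrass induction below.
  have hreal : star a = a := by
    have := hx.isSymmetric v v
    simp only [ContinuousLinearMap.coe_coe, h, inner_smul_left, inner_smul_right] at this
    exact mul_right_cancel₀ (inner_self_ne_zero.2 hv) this
  have key : ∀ f : C(spectrum ℂ x, ℂ), cfcHom hn f v = f ⟨a, ha⟩ • v := by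
    intro f
    induction f using ContinuousMap.induction_on_of_compact with
    | const r =>
      have : (ContinuousMap.const (spectrum ℂ x) r) = algebraMap ℂ _ r := rfl
      rw [this, AlgHomClass.commutes]
      simp [Algebra.algebraMap_eq_smul_one]
    | id => rw [cfcHom_id]; simpa using h
    | star_id =>
      rw [map_star, cfcHom_id, hx.star_eq]
      rw [h]
      exact congrArg (fun c : ℂ => c • v) hreal.symm
    | add f g hf hg => simp [hf, hg, add_smul]
    | mul f g hf hg => rw [map_mul, mul_apply_eq_comp, hg, map_smul, hf, smul_smul, ContinuousMap.mul_apply,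
      mul_comm]
    | frequently f hf =>
      have hcl : IsClosed {f : C(spectrum ℂ x, ℂ) | cfcHom hn f v = f ⟨a, ha⟩ • v} := by
        refine isClosed_eq ?_ ?_
        · exact (ContinuousLinearMap.apply ℂ H v).continuous.comp (cfcHom_continuous hn)
        · exact (continuous_eval_const _).smul continuous_const
      exact hcl.closure_subset (mem_closure_iff_frequently.2 hf)
  rw [cfc_apply g x hn hg, key]
  rfl

/-- `|y|` acts as `|a|` on a common eigenvector of `y` and `y⋆`. -/
theorem abs_apply_eigenvector {y : H →L[ℂ] H} {v : H} {a : ℂ} (h : y v = a • v)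
    (h' : star y v = star a • v) : (CFC.abs y : H →L[ℂ] H) v = ((‖a‖ : ℝ) : ℂ) • v := by
  set T : H →L[ℂ] H := CFC.abs y
  have hT : 0 ≤ T := CFC.abs_nonneg y
  have hTp : T.IsPositive := (ContinuousLinearMap.nonneg_iff_isPositive T).1 hT
  have hsq : T (T v) = ((‖a‖ : ℂ) * ‖a‖) • v := by
    rw [← mul_apply_eq_comp, CFC.abs_mul_abs, mul_apply_eq_comp, h,
      map_smul, h', smul_smul, ← sq, ← Complex.mul_conj']
    rfl
  -- As `T² v = ‖a‖² v`, this `w` is an eigenvector of `T` to `-‖a‖` or zero; positivity of `T`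
  -- excludes the former when `a ≠ 0`. For `a = 0`, `‖T v‖² = ⟪v, T² v⟫ = 0`.
  set w : H := T v - ((‖a‖ : ℝ) : ℂ) • v with hw
  have hTw : T w = -((‖a‖ : ℂ) • w) := by
    rw [hw, map_sub, hsq, map_smul, smul_sub, smul_smul]
    abel
  have h1 : 0 ≤ (⟪w, T w⟫_ℂ).re := hTp.re_inner_nonneg_right w
  rw [hTw, inner_neg_right, inner_smul_right, inner_self_eq_norm_sq_to_K] at h1
  have h2 : ‖a‖ * ‖w‖ ^ 2 ≤ 0 := by
    have : (-((‖a‖ : ℂ) * ((‖w‖ : ℝ) : ℂ) ^ 2)).re = -(‖a‖ * ‖w‖ ^ 2) := by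
      rw [← Complex.ofReal_pow, ← Complex.ofReal_mul, ← Complex.ofReal_neg, Complex.ofReal_re]
    have h1' : 0 ≤ (-((‖a‖ : ℂ) * ((‖w‖ : ℝ) : ℂ) ^ 2)).re := h1
    linarith
  suffices w = 0 from sub_eq_zero.1 this
  rcases (norm_nonneg a).eq_or_lt with h0 | h0
  · have h3 : ⟪T v, T v⟫_ℂ = 0 := by
      have := hTp.inner_left_eq_inner_right v (T v)
      rw [this, hsq, ← h0]; simp
    rw [hw, inner_self_eq_zero.1 h3, ← h0]; simp
  · have : ‖w‖ ^ 2 ≤ 0 := by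
      by_contra hcon
      exact absurd h2 (not_le.2 (mul_pos h0 (not_le.1 hcon)))
    simpa using this

variable {ι : Type u} (b : HilbertBasis ι ℂ H)

theorem star_apply_eigenbasis {y : H →L[ℂ] H} {k : ι → ℂ} (h : ∀ i, y (b i) = k i • b i) (i : ι) :
    star y (b i) = star (k i) • b i := by
  classical
  refine hilbertBasis_ext b fun j => ?_
  rw [ContinuousLinearMap.star_eq_adjoint, ContinuousLinearMap.adjoint_inner_right, h,
    inner_smul_left, inner_smul_right, hilbertBasis_inner_eq_ite]
  by_cases hij : j = i
  · subst hij; rfl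
  · simp [hij]

/-- The dimension of `eigenspan y l` counts the eigenvalues exceeding `l` in modulus. -/
theorem rank_eigenspan_lt_iff {y : H →L[ℂ] H} {k : ι → ℂ} (h : ∀ i, y (b i) = k i • b i)
    (l : ℝ) (n : ℕ) :
    Module.rank ℂ (eigenspan y l) < (n : Cardinal) ↔ Set.encard {i | l < ‖k i‖} < n := by
  classical
  set S : Set ι := {i | l < ‖k i‖} with hS
  have habs : ∀ i, (CFC.abs y : H →L[ℂ] H) (b i) = ((‖k i‖ : ℝ) : ℂ) • b i := fun i =>
    abs_apply_eigenvector (h i) (star_apply_eigenbasis b h i)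
  have hsub : Submodule.span ℂ (Set.range fun i : S => b i) ≤ eigenspan y l := by
    refine Submodule.span_le.2 ?_
    rintro _ ⟨⟨i, hi⟩, rfl⟩
    refine Submodule.mem_iSup_of_mem (p := fun t : Set.Ioi l => Module.End.eigenspace
      ((CFC.abs y : H →L[ℂ] H) : H →ₗ[ℂ] H) ((t : ℝ) : ℂ)) ⟨‖k i‖, hi⟩ ?_
    rw [Module.End.mem_eigenspace_iff]
    exact habs i
  have hli : LinearIndependent ℂ (fun i : S => b i) :=
    b.orthonormal.linearIndependent.comp _ Subtype.val_injective
  have hrank : Module.rank ℂ (Submodule.span ℂ (Set.range fun i : S => b i)) = Cardinal.mk S :=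
    (rank_span hli).trans (Cardinal.mk_range_eq _ hli.injective)
  have hle : Cardinal.mk S ≤ Module.rank ℂ (eigenspan y l) :=
    hrank ▸ Submodule.rank_mono hsub
  by_cases hfin : S.Finite
  -- An eigenvector of `|y|` to some `t > l` has no component along `b i` for `i ∉ S`, so its
  -- expansion is a finite sum.
  · have heq : eigenspan y l = Submodule.span ℂ (Set.range fun i : S => b i) := by
      refine le_antisymm (iSup_le ?_) hsub
      rintro ⟨t, ht⟩ v hv
      rw [Module.End.mem_eigenspace_iff] at hv
      have hv' : (CFC.abs y : H →L[ℂ] H) v = (t : ℂ) • v := hv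
      have hsa : ((CFC.abs y : H →L[ℂ] H)).IsSymmetric :=
        ((ContinuousLinearMap.nonneg_iff_isPositive _).1 (CFC.abs_nonneg y)).isSymmetric
      have h0 : ∀ i ∉ S, ⟪b i, v⟫_ℂ = 0 := by
        intro i hi
        have := hsa (b i) v
        simp only [ContinuousLinearMap.coe_coe, habs, hv', inner_smul_left, inner_smul_right,
          Complex.conj_ofReal] at this
        by_contra hne
        have h1 := Complex.ofReal_injective (mul_right_cancel₀ hne this)
        exact hi (show l < ‖k i‖ by rw [h1]; exact ht)
      have hsum := b.hasSum_repr v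
      have hsum' : HasSum (fun i => b.repr v i • b i) (∑ i ∈ hfin.toFinset, b.repr v i • b i) := by
        apply hasSum_sum_of_ne_finset_zero
        intro i hi
        rw [b.repr_apply_apply, h0 i (by simpa using hi), zero_smul]
      rw [hsum.unique hsum']
      refine Submodule.sum_mem _ fun i hi => Submodule.smul_mem _ _ (Submodule.subset_span ?_)
      exact ⟨⟨i, by simpa using hi⟩, rfl⟩
    rw [heq, hrank]
    have : Fintype S := hfin.fintype
    rw [Cardinal.mk_fintype, Set.encard_eq_coe_toFinset_card, Set.toFinset_card]
    norm_cast
  · have hinf : Set.Infinite S := hfin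
    rw [hinf.encard_eq]
    have h1 : Cardinal.aleph0 ≤ Cardinal.mk S := by
      have := hinf.to_subtype
      exact Cardinal.aleph0_le_mk S
    simp only [not_top_lt, iff_false, not_lt]
    exact (Cardinal.natCast_le_aleph0.trans h1).trans hle

/-- The `n`-th characteristic value exceeds `t` iff at least `n` eigenvalues do. -/
theorem lt_mu_iff {y : H →L[ℂ] H} {k : ι → ℂ} (h : ∀ i, y (b i) = k i • b i)
    {t : ℝ} (ht : 0 ≤ t) {n : ℕ} (hn : 1 ≤ n) :
    t < mu y n ↔ (n : ℕ∞) ≤ Set.encard {i | t < ‖k i‖} := by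
  have hmu : mu y n = sInf {l : ℝ | 0 ≤ l ∧ Set.encard {i | l < ‖k i‖} < n} := by
    simp only [mu, rank_eigenspan_lt_iff b h]
  have hbdd : BddBelow {l : ℝ | 0 ≤ l ∧ Set.encard {i | l < ‖k i‖} < n} := ⟨0, fun l hl => hl.1⟩
  have hne : ({l : ℝ | 0 ≤ l ∧ Set.encard {i | l < ‖k i‖} < n}).Nonempty := by
    refine ⟨‖y‖, norm_nonneg _, ?_⟩
    have : {i | ‖y‖ < ‖k i‖} = ∅ := by
      ext i; simpa using eigenvalue_norm_le b h i
    rw [this, Set.encard_empty]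
    exact_mod_cast hn
  rw [hmu]
  constructor
  · intro hlt
    by_contra hcon
    exact absurd (csInf_le hbdd ⟨ht, not_le.1 hcon⟩) (not_le.2 hlt)
  · intro hle
    -- The smallest modulus over `n` chosen indices exceeds `t` and bounds every admissible `l` from
    -- below, so the inequality stays strict at the infimum.
    obtain ⟨F, hF, hFc⟩ := Set.exists_subset_encard_eq hle
    have hFfin : F.Finite := Set.finite_of_encard_eq_coe hFc
    have hFne : F.Nonempty := by
      rw [← Set.encard_ne_zero, hFc]
      exact_mod_cast (by omega : n ≠ 0)
    obtain ⟨i, hiF, hi⟩ := Set.exists_min_image F (fun i => ‖k i‖) hFfin hFne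
    refine (hF hiF : t < ‖k i‖).trans_le (le_csInf hne ?_)
    rintro l ⟨-, hl⟩
    by_contra hcon
    rw [not_le] at hcon
    have : F ⊆ {i | l < ‖k i‖} := fun j hj => hcon.trans_le (hi j hj)
    exact absurd (hFc ▸ Set.encard_le_encard this) (not_le.2 hl)

/-- The trace of an operator can be computed as a matrix-coefficient sum in some basis. -/
theorem exists_tr_eq_tsum (y : H →L[ℂ] H) :
    ∃ (W : Set H) (e : HilbertBasis W ℂ H), tr y = ∑' i : W, ⟪e i, y (e i)⟫_ℂ := by
  obtain ⟨e, he⟩ := (exists_hilbertBasis ℂ H).choose_spec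
  refine ⟨_, e, ?_⟩
  rw [tr]
  exact tsum_congr fun i => by rw [he]

theorem hasSum_inner_diagonal {y : H →L[ℂ] H} {k : ι → ℂ} (h : ∀ i, y (b i) = k i • b i) (v : H) :
    HasSum (fun j => k j * (⟪v, b j⟫_ℂ * ⟪b j, v⟫_ℂ)) ⟪v, y v⟫_ℂ := by
  have h1 : ∀ j, ⟪v, b j⟫_ℂ * ⟪b j, y v⟫_ℂ = k j * (⟪v, b j⟫_ℂ * ⟪b j, v⟫_ℂ) := fun j => by
    rw [← ContinuousLinearMap.adjoint_inner_left, ← ContinuousLinearMap.star_eq_adjoint,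
      star_apply_eigenbasis b h, inner_smul_left, starRingEnd_apply, star_star]
    ring
  have h2 := b.hasSum_inner_mul_inner v (y v)
  rwa [funext h1] at h2

/-- The trace of a diagonal operator with summable eigenvalues is their sum. -/
theorem tr_eq_tsum {y : H →L[ℂ] H} {k : ι → ℂ} (h : ∀ i, y (b i) = k i • b i)
    (hk : Summable k) : tr y = ∑' i, k i := by
  obtain ⟨W, e, htr⟩ := exists_tr_eq_tsum y
  have hcol : ∀ j, HasSum (fun i => ⟪e i, b j⟫_ℂ * ⟪b j, e i⟫_ℂ) 1 := by
    intro j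
    have := e.hasSum_inner_mul_inner (b j) (b j)
    rw [inner_self_eq_norm_sq_to_K, b.orthonormal.1 j] at this
    simpa only [mul_comm, RCLike.ofReal_one, one_pow] using this
  have hnorm : ∀ i j, ‖⟪e i, b j⟫_ℂ * ⟪b j, e i⟫_ℂ‖ = (⟪e i, b j⟫_ℂ * ⟪b j, e i⟫_ℂ).re := by
    intro i j
    rw [← inner_conj_symm (b j) (e i), Complex.mul_conj', norm_pow, Complex.norm_real, norm_norm,
      ← Complex.ofReal_pow, Complex.ofReal_re]
  -- The basis `e` need not diagonalise `y`. By Parseval each column of norms sums to `‖k j‖`, which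
  -- permits exchanging the sums.
  have hsumm : Summable fun p : ι × W => k p.1 * (⟪e p.2, b p.1⟫_ℂ * ⟪b p.1, e p.2⟫_ℂ) := by
    apply Summable.of_norm
    rw [summable_prod_of_nonneg fun p => norm_nonneg _]
    have hc : ∀ j, HasSum (fun i => ‖k j * (⟪e i, b j⟫_ℂ * ⟪b j, e i⟫_ℂ)‖) ‖k j‖ := by
      intro j
      simp only [norm_mul (k j), hnorm]
      simpa using (Complex.hasSum_re (hcol j)).mul_left ‖k j‖
    exact ⟨fun j => (hc j).summable, by simpa only [(hc _).tsum_eq] using hk.norm⟩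
  rw [htr, tsum_congr fun i => (hasSum_inner_diagonal b h (e i)).tsum_eq.symm,
    Summable.tsum_comm (f := fun j i => k j * (⟪e i, b j⟫_ℂ * ⟪b j, e i⟫_ℂ)) hsumm]
  exact tsum_congr fun j => by rw [((hcol j).mul_left _).tsum_eq, mul_one]

end Diagonal

/-! ### Families with equal counting functions. -/

section Rearrangement

/-- If only finitely many values exceed `t / 2`, the values below `t` are bounded away from `t`. -/
theorem exists_gap_below {α : Type*} {a : α → ℝ} (hfin : ∀ t, 0 < t → {i | t < a i}.Finite)
    {t : ℝ} (ht : 0 < t) : ∃ s, 0 < s ∧ s < t ∧ ∀ i, s < a i → t ≤ a i := by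
  have hF : (a '' {i | t / 2 < a i ∧ a i < t}).Finite :=
    ((hfin (t / 2) (by positivity)).subset fun i hi => hi.1).image a
  have hev : ∀ᶠ s in 𝓝[<] t, ∀ v ∈ a '' {i | t / 2 < a i ∧ a i < t}, v < s := by
    rw [hF.eventually_all]
    rintro _ ⟨i, hi, rfl⟩
    exact mem_nhdsWithin_of_mem_nhds (lt_mem_nhds hi.2)
  have hev2 : ∀ᶠ s in 𝓝[<] t, t / 2 < s := mem_nhdsWithin_of_mem_nhds (lt_mem_nhds (by linarith))
  obtain ⟨s, ⟨hs1, hs2⟩, hst⟩ := ((hev.and hev2).and self_mem_nhdsWithin).exists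
  refine ⟨s, by linarith, hst, fun i hi => ?_⟩
  by_contra hcon
  exact absurd (hs1 _ ⟨i, ⟨by linarith, not_le.1 hcon⟩, rfl⟩) (not_lt.2 hi.le)

theorem encard_eq_add_encard_lt {γ : Type*} {f : γ → ℝ} {s t : ℝ} (hst : s < t)
    (hf : ∀ i, s < f i → t ≤ f i) :
    {i | f i = t}.encard + {i | t < f i}.encard = {i | s < f i}.encard := by
  rw [← Set.encard_union_eq]
  · congr 1
    ext i
    simp only [Set.mem_union, Set.mem_ofPred_eq]
    constructor
    · rintro (h | h) <;> linarith
    · intro h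
      rcases (hf i h).eq_or_lt with h | h
      · exact Or.inl h.symm
      · exact Or.inr h
  · rw [Set.disjoint_left]
    intro i hi hi'
    simp only [Set.mem_ofPred_eq] at hi hi'
    linarith

/-- The multiplicity of `t` is the drop of the counting function between `t` and a point just below
it in a common gap; finiteness allows the cancellation. -/
theorem encard_level_set_eq {α β : Type*} {a : α → ℝ} {c : β → ℝ}
    (hfin : ∀ t, 0 < t → {i | t < a i}.Finite)
    (heq : ∀ t, 0 < t → {i | t < a i}.encard = {j | t < c j}.encard) {t : ℝ} (ht : 0 < t) :
    {i | a i = t}.encard = {j | c j = t}.encard := by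
  have hfin' : ∀ t, 0 < t → {j | t < c j}.Finite := fun t ht => by
    rw [← Set.encard_lt_top_iff, ← heq t ht]
    exact (hfin t ht).encard_lt_top
  obtain ⟨s₁, hs₁, hst₁, h₁⟩ := exists_gap_below hfin ht
  obtain ⟨s₂, hs₂, hst₂, h₂⟩ := exists_gap_below hfin' ht
  set s := max s₁ s₂
  have hs : 0 < s := lt_max_of_lt_left hs₁
  have hst : s < t := max_lt hst₁ hst₂
  have ka := encard_eq_add_encard_lt hst fun i hi => h₁ i ((le_max_left _ _).trans_lt hi)
  have kc := encard_eq_add_encard_lt hst fun i hi => h₂ i ((le_max_right _ _).trans_lt hi)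
  rw [heq s hs, ← kc, heq t ht] at ka
  exact WithTop.add_right_cancel (hfin' t ht).encard_lt_top.ne ka

/-- Two families of reals with the same finite counting functions on `(0, ∞)` have the same
positive members. -/
theorem exists_equiv_of_encard_eq {α β : Type*} {a : α → ℝ} {c : β → ℝ}
    (hfin : ∀ t, 0 < t → {i | t < a i}.Finite)
    (heq : ∀ t, 0 < t → {i | t < a i}.encard = {j | t < c j}.encard) :
    ∃ e : {i // 0 < a i} ≃ {j // 0 < c j}, ∀ i, c (e i) = a i := by
  have hfib : ∀ t : ℝ, Nonempty ((fun i : {i // 0 < a i} => a i) ⁻¹' {t} ≃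
      (fun j : {j // 0 < c j} => c j) ⁻¹' {t}) := by
    intro t
    rcases le_or_gt t 0 with ht | ht
    · have h1 : IsEmpty ((fun i : {i // 0 < a i} => a i) ⁻¹' {t}) :=
        ⟨fun i => absurd i.1.2 (not_lt.2 ((Set.mem_singleton_iff.1 i.2).le.trans ht))⟩
      have h2 : IsEmpty ((fun i : {i // 0 < c i} => c i) ⁻¹' {t}) :=
        ⟨fun i => absurd i.1.2 (not_lt.2 ((Set.mem_singleton_iff.1 i.2).le.trans ht))⟩
      exact ⟨Equiv.equivOfIsEmpty _ _⟩
    · have e1 : (fun i : {i // 0 < a i} => a i) ⁻¹' {t} ≃ {i | a i = t} :=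
        ⟨fun i => ⟨i.1, i.2⟩, fun i => ⟨⟨i.1, (show a i.1 = t from i.2).symm ▸ ht⟩, i.2⟩,
          fun _ => rfl, fun _ => rfl⟩
      have e2 : (fun i : {i // 0 < c i} => c i) ⁻¹' {t} ≃ {i | c i = t} :=
        ⟨fun i => ⟨i.1, i.2⟩, fun i => ⟨⟨i.1, (show c i.1 = t from i.2).symm ▸ ht⟩, i.2⟩,
          fun _ => rfl, fun _ => rfl⟩
      have hlev := encard_level_set_eq hfin heq ht
      have hf1 : {i | a i = t}.Finite := (hfin (t / 2) (by positivity)).subset fun i hi => by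
        simp only [Set.mem_ofPred_eq] at hi ⊢; linarith
      have hf2 : {i | c i = t}.Finite := by
        rw [← Set.encard_lt_top_iff, ← hlev]; exact hf1.encard_lt_top
      have := hf1.to_subtype
      have := hf2.to_subtype
      have e3 : {i | a i = t} ≃ {i | c i = t} := (Finite.card_eq.1 (by
        rw [Nat.card_coe_set_eq, Nat.card_coe_set_eq, Set.ncard, Set.ncard, hlev])).some
      exact ⟨e1.trans (e3.trans e2.symm)⟩
  exact ⟨Equiv.ofPreimageEquiv fun t => (hfib t).some, fun i =>
    Equiv.ofPreimageEquiv_map (f := fun i : {i // 0 < a i} => a i)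
      (g := fun j : {j // 0 < c j} => c j) (fun t => (hfib t).some) i⟩

/-- Since `g 0 = 0`, zero members, whose number may differ, contribute nothing; the positive ones
correspond bijectively. -/
theorem hasSum_iff_of_encard_eq {α β E : Type*} [AddCommMonoid E] [TopologicalSpace E]
    {a : α → ℝ} {c : β → ℝ} (ha : ∀ i, 0 ≤ a i) (hc : ∀ j, 0 ≤ c j)
    (hfin : ∀ t, 0 < t → {i | t < a i}.Finite)
    (heq : ∀ t, 0 < t → {i | t < a i}.encard = {j | t < c j}.encard)
    {g : ℝ → E} (hg : g 0 = 0) {s : E} :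
    HasSum (fun i => g (a i)) s ↔ HasSum (fun j => g (c j)) s := by
  obtain ⟨e, he⟩ := exists_equiv_of_encard_eq hfin heq
  have h1 : HasSum (fun i : {i // 0 < a i} => g (a i)) s ↔ HasSum (fun i => g (a i)) s := by
    refine hasSum_subtype_iff_of_support_subset (f := fun i => g (a i)) (s := {i | 0 < a i}) ?_
    intro i hi
    refine (ha i).lt_of_ne fun h => hi ?_
    simp only [← h, hg]
  have h2 : HasSum (fun i : {i // 0 < c i} => g (c i)) s ↔ HasSum (fun i => g (c i)) s := by
    refine hasSum_subtype_iff_of_support_subset (f := fun i => g (c i)) (s := {i | 0 < c i}) ?_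
    intro i hi
    refine (hc i).lt_of_ne fun h => hi ?_
    simp only [← h, hg]
  rw [← h1, ← h2, ← e.hasSum_iff]
  simp only [Function.comp_def, he]

end Rearrangement

/-! ### Complex powers of a positive compact operator and their traces. -/

section Powers

universe u

variable {H : Type u} [NormedAddCommGroup H] [InnerProductSpace ℂ H] [CompleteSpace H]
  {ι : Type u} (b : HilbertBasis ι ℂ H)

theorem hasSum_mu_iff {E : Type*} [AddCommMonoid E] [TopologicalSpace E]
    {y : H →L[ℂ] H} {k : ι → ℂ} (h : ∀ i, y (b i) = k i • b i)
    (hfin : ∀ t, 0 < t → {i | t < ‖k i‖}.Finite) {g : ℝ → E} (hg : g 0 = 0) {s : E} :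
    HasSum (fun i => g ‖k i‖) s ↔ HasSum (fun n : ℕ => g (mu y (n + 1))) s := by
  refine hasSum_iff_of_encard_eq (fun i => norm_nonneg _) (fun n => mu_nonneg y _) hfin ?_ hg
  intro t ht
  obtain ⟨N, hN⟩ := (hfin t ht).exists_encard_eq_coe
  have : {n : ℕ | t < mu y (n + 1)} = Set.Iio N := by
    ext n
    rw [Set.mem_ofPred_eq, lt_mu_iff b h ht.le (by omega), hN, Set.mem_Iio, Nat.cast_le]
    omega
  rw [this, hN, ← Finset.coe_Iio, Set.encard_coe_eq_coe_finsetCard, Nat.card_Iio]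

/-- If the characteristic values tend to zero, finitely many eigenvalues exceed any `t > 0`. -/
theorem finite_of_tendsto_mu {y : H →L[ℂ] H} {k : ι → ℂ} (h : ∀ i, y (b i) = k i • b i)
    (hmu : Tendsto (fun n => mu y n) atTop (𝓝 0)) {t : ℝ} (ht : 0 < t) :
    {i | t < ‖k i‖}.Finite := by
  by_contra hinf
  obtain ⟨n, hn, hn1⟩ := ((hmu.eventually (gt_mem_nhds ht)).and (eventually_ge_atTop 1)).exists
  have : t < mu y n := (lt_mu_iff b h ht.le hn1).2 (by
    rw [Set.Infinite.encard_eq hinf]; exact le_top)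
  exact lt_asymm hn this

theorem exists_eigenbasis_of_nonneg {x : H →L[ℂ] H} (hc : IsCompactOperator x) (hx : 0 ≤ x) :
    ∃ (ι : Type u) (b : HilbertBasis ι ℂ H) (a : ι → ℝ), (∀ i, 0 ≤ a i) ∧
      ∀ i, x (b i) = (a i : ℂ) • b i := by
  have hp := (ContinuousLinearMap.nonneg_iff_isPositive x).1 hx
  obtain ⟨ι, b, k, hk⟩ := exists_hilbertBasis_eigenvectors hc hp.isSymmetric
  have hnn : ∀ i, 0 ≤ k i := fun i => by
    have := hp.inner_nonneg_right (b i)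
    rw [hk, inner_smul_right, inner_self_eq_norm_sq_to_K, b.orthonormal.1 i] at this
    simpa using this
  refine ⟨ι, b, fun i => (k i).re, fun i => (Complex.nonneg_iff.1 (hnn i)).1, fun i => ?_⟩
  rw [hk]
  congr 1
  exact Complex.ext rfl (by simpa using (Complex.nonneg_iff.1 (hnn i)).2.symm)

/-- The spectrum lies in `[0, ∞)`, which meets the branch cut only at `0`, where `Re z > 0` gives
continuity. -/
theorem continuousOn_cpow_spectrum {x : H →L[ℂ] H} (hx : 0 ≤ x) {z : ℂ} (hz : 0 < z.re) :
    ContinuousOn (fun t : ℂ => t ^ z) (spectrum ℂ x) := by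
  intro t ht
  have htn : 0 ≤ t := spectrum_nonneg_of_nonneg hx ht
  by_cases h0 : t = 0
  · subst h0
    exact (Complex.continuousAt_cpow_zero_of_re_pos hz |>.comp
      (f := fun t : ℂ => (t, z)) (by fun_prop)).continuousWithinAt
  · refine (continuousAt_cpow_const ?_).continuousWithinAt
    rw [Complex.nonneg_iff] at htn
    refine Or.inl (htn.1.lt_of_ne fun h => h0 (Complex.ext h.symm htn.2.symm))

/-- Factor `x ^ z = x * x ^ (z - 1)`; the second factor is bounded because `Re (z - 1) > 0`. -/
theorem isCompactOperator_pow {x : H →L[ℂ] H} (hc : IsCompactOperator x) (hx : 0 ≤ x) {z : ℂ}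
    (hz : 1 < z.re) : IsCompactOperator (pow x z) := by
  have hn : IsStarNormal x := (IsSelfAdjoint.of_nonneg hx).isStarNormal
  have h : pow x z = x * pow x (z - 1) := by
    have h1 : (fun t : ℂ => t ^ z) = fun t : ℂ => t * t ^ (z - 1) := by
      ext t
      by_cases h0 : t = 0
      · subst h0
        rw [zero_mul, Complex.zero_cpow]
        rintro rfl; simp at hz; linarith
      · rw [Complex.cpow_sub _ _ h0, Complex.cpow_one]; field_simp
    rw [pow, h1, cfc_mul (fun t : ℂ => t) (fun t : ℂ => t ^ (z - 1)) x continuousOn_id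
      (continuousOn_cpow_spectrum hx (by simpa using hz)), cfc_id' ℂ x, pow]
  rw [h]
  exact hc.comp_clm (pow x (z - 1))

theorem pow_apply_eigenvector {x : H →L[ℂ] H} (hx : 0 ≤ x) {v : H} (hv : v ≠ 0) {a : ℂ}
    (h : x v = a • v) {z : ℂ} (hz : 0 < z.re) : pow x z v = (a ^ z) • v :=
  cfc_apply_eigenvector (IsSelfAdjoint.of_nonneg hx) hv h (continuousOn_cpow_spectrum hx hz)

theorem norm_ofReal_cpow {a : ℝ} (ha : 0 ≤ a) {z : ℂ} (hz : 0 < z.re) :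
    ‖(a : ℂ) ^ z‖ = a ^ z.re := by
  rcases ha.eq_or_lt with rfl | h
  · have : z ≠ 0 := by rintro rfl; simp at hz
    simp [this, Real.zero_rpow hz.ne']
  · exact Complex.norm_cpow_eq_rpow_re_of_pos h z

/-- Powers `x ^ z` are trace class, with trace `∑ μ_n(x) ^ z`, when `∑ μ_n(x) ^ Re z < ∞`. -/
theorem isTraceClass_pow_and_zeta_eq {x : H →L[ℂ] H} (hc : IsCompactOperator x) (hx : 0 ≤ x)
    (hmu : Tendsto (fun n => mu x n) atTop (𝓝 0)) {z : ℂ} (hz : 1 < z.re)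
    (hs : Summable fun n : ℕ => mu x (n + 1) ^ z.re) :
    IsTraceClass (pow x z) ∧ zeta x z = ∑' n : ℕ, (mu x (n + 1) : ℂ) ^ z := by
  obtain ⟨ι, b, a, ha, hb⟩ := exists_eigenbasis_of_nonneg hc hx
  have hz0 : 0 < z.re := by linarith
  have hz0' : z ≠ 0 := by rintro rfl; simp at hz0
  have hne : ∀ i, b i ≠ 0 := fun i => b.orthonormal.ne_zero i
  have hpow : ∀ i, pow x z (b i) = ((a i : ℂ) ^ z) • b i := fun i =>
    pow_apply_eigenvector hx (hne i) (hb i) hz0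
  have hna : ∀ i, ‖(a i : ℂ)‖ = a i := fun i => by
    rw [Complex.norm_real, Real.norm_of_nonneg (ha i)]
  have hfin : ∀ t, 0 < t → {i | t < ‖(a i : ℂ)‖}.Finite := fun t ht =>
    finite_of_tendsto_mu b hb hmu ht
  have hfin' : ∀ t, 0 < t → {i | t < ‖(a i : ℂ) ^ z‖}.Finite := by
    intro t ht
    refine (hfin (t ^ z.re⁻¹) (by positivity)).subset fun i hi => ?_
    simp only [Set.mem_ofPred_eq, norm_ofReal_cpow (ha i) hz0, hna] at hi ⊢
    rwa [Real.rpow_inv_lt_iff_of_pos ht.le (ha i) hz0]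
  have hsa : Summable fun i => ‖(a i : ℂ) ^ z‖ := by
    obtain ⟨S, hS⟩ := hs
    have := (hasSum_mu_iff b hb hfin (g := fun t => t ^ z.re) (Real.zero_rpow hz0.ne')).2 hS
    simp only [norm_ofReal_cpow (ha _) hz0]
    simpa only [hna] using this.summable
  refine ⟨⟨isCompactOperator_pow hc hx hz, ?_⟩, ?_⟩
  · exact ((hasSum_mu_iff b hpow hfin' (g := id) rfl).1 hsa.hasSum).summable
  · rw [zeta, tr_eq_tsum b hpow hsa.of_norm]
    have h := hsa.of_norm.hasSum
    have h' : HasSum (fun i => ((‖(a i : ℂ)‖ : ℝ) : ℂ) ^ z) (∑' i, (a i : ℂ) ^ z) := by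
      simpa only [hna] using h
    exact ((hasSum_mu_iff b hb hfin (g := fun t : ℝ => (t : ℂ) ^ z) (by simp [hz0'])).1
      h').tsum_eq.symm

end Powers

/-! ### Karamata's proof of the Hardy–Littlewood Tauberian theorem. -/

section Tauberian

/-- The test function `u⁻¹ 1_{u ≥ 1/e}` of Karamata's argument. -/
noncomputable def karamataTest (u : ℝ) : ℝ := if Real.exp (-1) ≤ u then u⁻¹ else 0

theorem integral_inv_exp_neg_one : ∫ u in Real.exp (-1)..1, u⁻¹ = (1 : ℝ) := by
  rw [integral_inv_of_pos (Real.exp_pos _) one_pos, one_div, ← Real.exp_neg, neg_neg, Real.log_exp]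

theorem exists_continuous_ge_karamataTest {δ : ℝ} (hδ : 0 < δ) :
    ∃ g : ℝ → ℝ, Continuous g ∧ (∀ u, 0 ≤ u → karamataTest u ≤ g u) ∧
      ∫ u in (0 : ℝ)..1, g u ≤ 1 + δ := by
  obtain ⟨m, hm⟩ := exists_nat_one_div_lt hδ
  set c := Real.exp (-1) with hcdef
  have hc : 0 < c := Real.exp_pos _
  have hc1 : c ≤ 1 := Real.exp_le_one_iff.2 (by norm_num)
  have hmax : ∀ u, 0 < max u c := fun u => lt_max_of_lt_right hc
  -- The jump at `c = 1/e` becomes a steep power `u ^ m / c ^ (m + 1)`, of integral `1 / (m + 1)`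
  -- over `[0, c]`.
  let g : ℝ → ℝ := fun u => (min (u / c) 1) ^ m * (max u c)⁻¹
  have hg : Continuous g :=
    Continuous.mul (by fun_prop) (Continuous.inv₀ (by fun_prop) fun u => (hmax u).ne')
  refine ⟨g, hg, fun u hu => ?_, ?_⟩
  · rw [karamataTest]
    split_ifs with h
    · have h' : c ≤ u := h
      have h1 : (1 : ℝ) ≤ u / c := (one_le_div hc).2 h'
      simp only [g, min_eq_right h1, max_eq_left h', one_pow, one_mul, le_refl]
    · have := hmax u
      positivity
  · rw [← intervalIntegral.integral_add_adjacent_intervals (b := c) (hg.intervalIntegrable _ _)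
      (hg.intervalIntegrable _ _)]
    have h1 : ∫ u in (0 : ℝ)..c, g u = ∫ u in (0 : ℝ)..c, u ^ m * (c ^ (m + 1))⁻¹ := by
      refine intervalIntegral.integral_congr fun u hu => ?_
      rw [Set.uIcc_of_le hc.le] at hu
      have h2 : u / c ≤ 1 := (div_le_one hc).2 hu.2
      simp only [g, min_eq_left h2, max_eq_right hu.2, div_pow, pow_succ]
      field_simp
    have h2 : ∫ u in c..1, g u = ∫ u in c..1, u⁻¹ := by
      refine intervalIntegral.integral_congr fun u hu => ?_
      rw [Set.uIcc_of_le hc1] at hu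
      have h3 : (1 : ℝ) ≤ u / c := (one_le_div hc).2 hu.1
      simp only [g, min_eq_right h3, max_eq_left hu.1, one_pow, one_mul]
    rw [h1, h2, integral_inv_exp_neg_one, intervalIntegral.integral_mul_const, integral_pow]
    have h4 : (c ^ (m + 1) - 0 ^ (m + 1)) / ((m : ℝ) + 1) * (c ^ (m + 1))⁻¹ = 1 / (m + 1) := by
      rw [zero_pow (by omega)]; field_simp; ring
    rw [h4]
    linarith

theorem exists_continuous_le_karamataTest {δ : ℝ} (hδ : 0 < δ) :
    ∃ g : ℝ → ℝ, Continuous g ∧ (∀ u, 0 ≤ u → g u ≤ karamataTest u) ∧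
      1 - δ ≤ ∫ u in (0 : ℝ)..1, g u := by
  obtain ⟨m, hm⟩ := exists_nat_one_div_lt hδ
  set c := Real.exp (-1) with hcdef
  have hc : 0 < c := Real.exp_pos _
  have hc1 : c ≤ 1 := Real.exp_le_one_iff.2 (by norm_num)
  have hmax : ∀ u, 0 < max u c := fun u => lt_max_of_lt_right hc
  -- The subtracted term cancels `u⁻¹` at `u = c` and integrates to `(1 - c ^ (m + 1)) / (m + 1)`
  -- over `[c, 1]`.
  let g : ℝ → ℝ := fun u => (max u c)⁻¹ - c ^ (m + 1) * ((max u c)⁻¹) ^ (m + 2)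
  have hinv : Continuous fun u : ℝ => (max u c)⁻¹ :=
    Continuous.inv₀ (by fun_prop) fun u => (hmax u).ne'
  have hg : Continuous g := by fun_prop
  have hg0 : ∀ u, u ≤ c → g u = 0 := fun u hu => by
    simp only [g, max_eq_right hu, inv_pow, pow_succ]
    field_simp
    ring
  refine ⟨g, hg, fun u hu => ?_, ?_⟩
  · rw [karamataTest]
    split_ifs with h
    · have h' : c ≤ u := h
      simp only [g, max_eq_left h']
      have : 0 ≤ c ^ (m + 1) * u⁻¹ ^ (m + 2) := by positivity
      linarith
    · exact (hg0 u (not_le.1 h).le).le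
  · rw [← intervalIntegral.integral_add_adjacent_intervals (b := c) (hg.intervalIntegrable _ _)
      (hg.intervalIntegrable _ _)]
    have h1 : ∫ u in (0 : ℝ)..c, g u = ∫ u in (0 : ℝ)..c, (0 : ℝ) := by
      refine intervalIntegral.integral_congr fun u hu => ?_
      rw [Set.uIcc_of_le hc.le] at hu
      exact hg0 u hu.2
    have h2 : ∫ u in c..1, g u = ∫ u in c..1, (u⁻¹ - c ^ (m + 1) * u ^ (-(m + 2 : ℕ) : ℤ)) := by
      refine intervalIntegral.integral_congr fun u hu => ?_
      rw [Set.uIcc_of_le hc1] at hu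
      simp only [g, max_eq_left hu.1, zpow_neg, zpow_natCast, inv_pow]
    have h0 : (0 : ℝ) ∉ Set.uIcc c 1 := by
      rw [Set.uIcc_of_le hc1]
      exact fun h => absurd h.1 (not_le.2 hc)
    rw [h1, h2, intervalIntegral.integral_sub, integral_inv_exp_neg_one,
      intervalIntegral.integral_const_mul, integral_zpow (Or.inr ⟨by omega, h0⟩),
      intervalIntegral.integral_const, smul_zero]
    · have h5 : (-((m + 2 : ℕ) : ℤ) + 1) = -((m + 1 : ℕ) : ℤ) := by push_cast; ring
      rw [h5, zpow_neg, zpow_neg, zpow_natCast, zpow_natCast]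
      have h6 : c ^ (m + 1) * (((1 : ℝ) ^ (m + 1))⁻¹ - (c ^ (m + 1))⁻¹) /
          (((-((m + 2 : ℕ) : ℤ) : ℤ) : ℝ) + 1) = (1 - c ^ (m + 1)) * (1 / (m + 1)) := by
        have h7 : (((-((m + 2 : ℕ) : ℤ) : ℤ) : ℝ) + 1) = -((m : ℝ) + 1) := by push_cast; ring
        rw [h7]
        field_simp
        ring
      have h8 : 0 ≤ c ^ (m + 1) * (1 / ((m : ℝ) + 1)) := by positivity
      rw [← mul_div_assoc, h6]
      nlinarith
    · exact intervalIntegral.intervalIntegrable_inv (fun u hu => fun h => h0 (h ▸ hu))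
        continuousOn_id
    · exact (intervalIntegral.intervalIntegrable_zpow (Or.inr h0)).const_mul _

theorem exists_polynomial_ge_karamataTest {δ : ℝ} (hδ : 0 < δ) :
    ∃ q : Polynomial ℝ, (∀ u ∈ Set.Icc (0 : ℝ) 1, karamataTest u ≤ q.eval u) ∧
      ∫ u in (0 : ℝ)..1, q.eval u ≤ 1 + δ := by
  obtain ⟨g, hg, hle, hint⟩ := exists_continuous_ge_karamataTest (half_pos hδ)
  -- Shifting by `δ / 4` and approximating within `δ / 4` puts `q` between `g` and `g + δ / 2`.
  obtain ⟨q, hq⟩ := exists_polynomial_near_of_continuousOn 0 1 (fun u => g u + δ / 4)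
    (by fun_prop) (δ / 4) (by positivity)
  refine ⟨q, fun u hu => ?_, ?_⟩
  · have := abs_lt.1 (hq u hu)
    linarith [hle u hu.1]
  · have h : ∫ u in (0 : ℝ)..1, q.eval u ≤ ∫ u in (0 : ℝ)..1, (g u + δ / 2) := by
      refine intervalIntegral.integral_mono_on zero_le_one (q.continuous.intervalIntegrable _ _)
        (Continuous.intervalIntegrable (by fun_prop) _ _) fun u hu => ?_
      have := abs_lt.1 (hq u hu)
      linarith
    rw [intervalIntegral.integral_add (hg.intervalIntegrable _ _) (by simp),
      intervalIntegral.integral_const] at h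
    simp only [sub_zero, one_smul] at h
    linarith

theorem exists_polynomial_le_karamataTest {δ : ℝ} (hδ : 0 < δ) :
    ∃ q : Polynomial ℝ, (∀ u ∈ Set.Icc (0 : ℝ) 1, q.eval u ≤ karamataTest u) ∧
      1 - δ ≤ ∫ u in (0 : ℝ)..1, q.eval u := by
  obtain ⟨g, hg, hle, hint⟩ := exists_continuous_le_karamataTest (half_pos hδ)
  obtain ⟨q, hq⟩ := exists_polynomial_near_of_continuousOn 0 1 (fun u => g u - δ / 4)
    (by fun_prop) (δ / 4) (by positivity)
  refine ⟨q, fun u hu => ?_, ?_⟩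
  · have := abs_lt.1 (hq u hu)
    linarith [hle u hu.1]
  · have h : ∫ u in (0 : ℝ)..1, (g u - δ / 2) ≤ ∫ u in (0 : ℝ)..1, q.eval u := by
      refine intervalIntegral.integral_mono_on zero_le_one
        (Continuous.intervalIntegrable (by fun_prop) _ _) (q.continuous.intervalIntegrable _ _)
        fun u hu => ?_
      have := abs_lt.1 (hq u hu)
      linarith
    rw [intervalIntegral.integral_sub (hg.intervalIntegrable _ _) (by simp),
      intervalIntegral.integral_const] at h
    simp only [sub_zero, one_smul] at h
    linarith

/-- The functional `ε ∑ a_n ^ (1 + ε) g (a_n ^ ε)`. -/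
noncomputable def karamataMean (a : ℕ → ℝ) (g : ℝ → ℝ) (ε : ℝ) : ℝ :=
  ε * ∑' n, a n ^ (1 + ε) * g (a n ^ ε)

variable {a : ℕ → ℝ}

theorem summable_rpow_of_le_inv {C : ℝ} (ha : ∀ n, 0 ≤ a n) (hC : ∀ n, a n ≤ C / (n + 1))
    {s : ℝ} (hs : 1 < s) : Summable fun n => a n ^ s := by
  have hC0 : 0 ≤ C := by simpa using (ha 0).trans (hC 0)
  have h1 : Summable fun n : ℕ => C ^ s * (1 / ((n + 1 : ℕ) : ℝ) ^ s) :=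
    ((summable_nat_add_iff 1).2 (Real.summable_one_div_nat_rpow.2 hs)).mul_left _
  refine Summable.of_nonneg_of_le (fun n => Real.rpow_nonneg (ha n) _) (fun n => ?_) h1
  rw [mul_one_div, ← Real.div_rpow hC0 (by positivity)]
  refine Real.rpow_le_rpow (ha n) ?_ (by linarith)
  simpa using hC n

theorem summable_karamataMean (ha : ∀ n, 0 ≤ a n) (ha1 : ∀ n, a n ≤ 1)
    (hs : ∀ s : ℝ, 1 < s → Summable fun n => a n ^ s) {g : ℝ → ℝ} {B : ℝ}
    (hg : ∀ u ∈ Set.Icc (0 : ℝ) 1, |g u| ≤ B) {ε : ℝ} (hε : 0 < ε) :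
    Summable fun n => a n ^ (1 + ε) * g (a n ^ ε) := by
  refine Summable.of_norm_bounded ((hs (1 + ε) (by linarith)).mul_right B) fun n => ?_
  rw [norm_mul, Real.norm_of_nonneg (Real.rpow_nonneg (ha n) _)]
  exact mul_le_mul_of_nonneg_left (hg _ ⟨Real.rpow_nonneg (ha n) _,
    Real.rpow_le_one (ha n) (ha1 n) hε.le⟩) (Real.rpow_nonneg (ha n) _)

theorem exists_bound_polynomial (p : Polynomial ℝ) :
    ∃ B, ∀ u ∈ Set.Icc (0 : ℝ) 1, |p.eval u| ≤ B := by
  obtain ⟨B, hB⟩ := isCompact_Icc.exists_bound_of_continuousOn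
    (p.continuous.continuousOn (s := Set.Icc (0 : ℝ) 1))
  exact ⟨B, hB⟩

theorem abs_karamataTest_le (u : ℝ) : |karamataTest u| ≤ Real.exp 1 := by
  rw [karamataTest]
  split_ifs with h
  · have hu : 0 < u := (Real.exp_pos (-1)).trans_le h
    rw [abs_of_pos (inv_pos.2 hu), inv_le_comm₀ hu (Real.exp_pos _), ← Real.exp_neg]
    exact h
  · simpa using (Real.exp_pos 1).le

theorem karamataMean_mono (ha : ∀ n, 0 ≤ a n) (ha1 : ∀ n, a n ≤ 1)
    (hs : ∀ s : ℝ, 1 < s → Summable fun n => a n ^ s) {f g : ℝ → ℝ} {B B' : ℝ}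
    (hf : ∀ u ∈ Set.Icc (0 : ℝ) 1, |f u| ≤ B) (hg : ∀ u ∈ Set.Icc (0 : ℝ) 1, |g u| ≤ B')
    (hfg : ∀ u ∈ Set.Icc (0 : ℝ) 1, f u ≤ g u) {ε : ℝ} (hε : 0 < ε) :
    karamataMean a f ε ≤ karamataMean a g ε := by
  refine mul_le_mul_of_nonneg_left (Summable.tsum_le_tsum (fun n => ?_)
    (summable_karamataMean ha ha1 hs hf hε) (summable_karamataMean ha ha1 hs hg hε)) hε.le
  exact mul_le_mul_of_nonneg_left (hfg _ ⟨Real.rpow_nonneg (ha n) _,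
    Real.rpow_le_one (ha n) (ha1 n) hε.le⟩) (Real.rpow_nonneg (ha n) _)

/-- For `u ^ k` the exponent becomes `1 + (k + 1) ε`, so the hypothesis at `(k + 1) ε` gives `L / (k
+ 1) = L ∫₀¹ u ^ k`; linearity does the rest. -/
theorem tendsto_karamataMean_polynomial (ha : ∀ n, 0 ≤ a n) (ha1 : ∀ n, a n ≤ 1)
    (hs : ∀ s : ℝ, 1 < s → Summable fun n => a n ^ s) {L : ℝ}
    (hL : Tendsto (fun ε : ℝ => ε * ∑' n, a n ^ (1 + ε)) (𝓝[>] 0) (𝓝 L)) (p : Polynomial ℝ) :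
    Tendsto (karamataMean a fun u => p.eval u) (𝓝[>] 0) (𝓝 (L * ∫ u in (0 : ℝ)..1, p.eval u)) := by
  induction p using Polynomial.induction_on' with
  | add p q hp hq =>
    obtain ⟨B, hB⟩ := exists_bound_polynomial p
    obtain ⟨B', hB'⟩ := exists_bound_polynomial q
    simp only [Polynomial.eval_add]
    rw [intervalIntegral.integral_add (p.continuous.intervalIntegrable _ _)
      (q.continuous.intervalIntegrable _ _), mul_add]
    refine (hp.add hq).congr' ?_
    filter_upwards [self_mem_nhdsWithin] with ε (hε : 0 < ε)
    rw [karamataMean, karamataMean, karamataMean, ← mul_add,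
      ← (summable_karamataMean ha ha1 hs hB hε).tsum_add
        (summable_karamataMean ha ha1 hs hB' hε)]
    simp only [mul_add]
  | monomial k r =>
    simp only [Polynomial.eval_monomial]
    rw [intervalIntegral.integral_const_mul, integral_pow]
    have hk : Tendsto (fun ε : ℝ => ((k : ℝ) + 1) * ε) (𝓝[>] 0) (𝓝[>] 0) := by
      refine tendsto_nhdsWithin_of_tendsto_nhds_of_eventually_within _ ?_ ?_
      · have : Tendsto (fun ε : ℝ => ((k : ℝ) + 1) * ε) (𝓝 0) (𝓝 (((k : ℝ) + 1) * 0)) :=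
          (continuous_const.mul continuous_id).tendsto 0
        rw [mul_zero] at this
        exact this.mono_left nhdsWithin_le_nhds
      · filter_upwards [self_mem_nhdsWithin] with ε (hε : 0 < ε)
        exact mul_pos (by positivity) hε
    have h := (hL.comp hk).mul_const (r / ((k : ℝ) + 1))
    have heq : L * (r * ((1 ^ (k + 1) - 0 ^ (k + 1)) / ((k : ℝ) + 1))) = L * (r / (k + 1)) := by
      rw [zero_pow (by omega)]; ring
    rw [heq]
    refine h.congr' ?_
    filter_upwards [self_mem_nhdsWithin] with ε (hε : 0 < ε)
    have hterm : ∀ n, a n ^ (1 + ε) * (r * (a n ^ ε) ^ k) = r * a n ^ (1 + ((k : ℝ) + 1) * ε) := by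
      intro n
      rw [← Real.rpow_natCast, ← Real.rpow_mul (ha n), mul_left_comm]
      rcases (ha n).eq_or_lt with h0 | h0
      · have hk1 : 0 < 1 + ((k : ℝ) + 1) * ε := by positivity
        have hk2 : 0 < 1 + ε := by positivity
        rw [← h0, Real.zero_rpow hk1.ne', Real.zero_rpow hk2.ne', zero_mul]
      · rw [← Real.rpow_add h0]
        ring_nf
    simp only [karamataMean, hterm, tsum_mul_left, Function.comp_apply]
    field_simp

theorem tendsto_karamataMean_karamataTest (ha : ∀ n, 0 ≤ a n) (ha1 : ∀ n, a n ≤ 1)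
    (hs : ∀ s : ℝ, 1 < s → Summable fun n => a n ^ s) {L : ℝ}
    (hL : Tendsto (fun ε : ℝ => ε * ∑' n, a n ^ (1 + ε)) (𝓝[>] 0) (𝓝 L)) :
    Tendsto (karamataMean a karamataTest) (𝓝[>] 0) (𝓝 L) := by
  have hL0 : 0 ≤ L := by
    refine ge_of_tendsto hL ?_
    filter_upwards [self_mem_nhdsWithin] with ε (hε : 0 < ε)
    exact mul_nonneg hε.le (tsum_nonneg fun n => Real.rpow_nonneg (ha n) _)
  rw [tendsto_order]
  constructor
  · intro l hl
    obtain ⟨δ, hδ, hδl⟩ : ∃ δ : ℝ, 0 < δ ∧ l < L * (1 - δ) := by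
      -- Dividing by `L + 1` instead of `L` covers `L = 0`.
      refine ⟨(L - l) / (2 * (L + 1)), div_pos (by linarith) (by positivity), ?_⟩
      have : L * ((L - l) / (2 * (L + 1))) ≤ (L - l) / 2 := by
        rw [← mul_div_assoc, div_le_div_iff₀ (by positivity) (by positivity)]
        nlinarith
      linarith
    obtain ⟨p, hp, hint⟩ := exists_polynomial_le_karamataTest hδ
    obtain ⟨B, hB⟩ := exists_bound_polynomial p
    have h := (tendsto_karamataMean_polynomial ha ha1 hs hL p).eventually
      (lt_mem_nhds (hδl.trans_le (mul_le_mul_of_nonneg_left hint hL0)))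
    filter_upwards [h, self_mem_nhdsWithin] with ε h (hε : 0 < ε)
    exact h.trans_le (karamataMean_mono ha ha1 hs hB (fun u _ => abs_karamataTest_le u) hp hε)
  · intro l hl
    obtain ⟨δ, hδ, hδl⟩ : ∃ δ : ℝ, 0 < δ ∧ L * (1 + δ) < l := by
      refine ⟨(l - L) / (2 * (L + 1)), div_pos (by linarith) (by positivity), ?_⟩
      have : L * ((l - L) / (2 * (L + 1))) ≤ (l - L) / 2 := by
        rw [← mul_div_assoc, div_le_div_iff₀ (by positivity) (by positivity)]
        nlinarith
      linarith
    obtain ⟨p, hp, hint⟩ := exists_polynomial_ge_karamataTest hδ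
    obtain ⟨B, hB⟩ := exists_bound_polynomial p
    have h := (tendsto_karamataMean_polynomial ha ha1 hs hL p).eventually
      (gt_mem_nhds ((mul_le_mul_of_nonneg_left hint hL0).trans_lt hδl))
    filter_upwards [h, self_mem_nhdsWithin] with ε h (hε : 0 < ε)
    exact (karamataMean_mono ha ha1 hs (fun u _ => abs_karamataTest_le u) hB hp hε).trans_lt h

/-- With `ε = 1 / log N`, the threshold `t ^ ε ≥ 1/e` reads `t ≥ 1/N`, and the factor `u⁻¹ = t ^
(-ε)` reduces `t ^ (1 + ε)` to `t`. -/
theorem rpow_mul_karamataTest {t : ℝ} (ht : 0 ≤ t) {N : ℕ} (hN : 2 ≤ N) :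
    t ^ (1 + (Real.log N)⁻¹) * karamataTest (t ^ (Real.log N)⁻¹) =
      if (N : ℝ)⁻¹ ≤ t then t else 0 := by
  have hN0 : (0 : ℝ) < N := by positivity
  have hlog : 0 < Real.log N := Real.log_pos (by exact_mod_cast hN)
  have hiff : Real.exp (-1) ≤ t ^ (Real.log N)⁻¹ ↔ (N : ℝ)⁻¹ ≤ t := by
    rw [Real.le_rpow_inv_iff_of_pos (Real.exp_pos _).le ht hlog, ← Real.exp_mul, neg_one_mul,
      Real.exp_neg, Real.exp_log hN0]
  rw [karamataTest]
  simp only [hiff]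
  split_ifs with h
  · have ht0 : 0 < t := (inv_pos.2 hN0).trans_le h
    rw [Real.rpow_add ht0, Real.rpow_one, mul_assoc, mul_inv_cancel₀ (by positivity), mul_one]
  · rw [mul_zero]

/-- Hardy–Littlewood Tauberian theorem for sequences bounded by `1 / (n + 1)`. -/
theorem tendsto_sum_div_log_of_le_inv (ha : ∀ n, 0 ≤ a n) (ha1 : ∀ n : ℕ, a n ≤ 1 / (n + 1))
    {L : ℝ} (hL : Tendsto (fun s : ℝ => (s - 1) * ∑' n, a n ^ s) (𝓝[>] 1) (𝓝 L)) :
    Tendsto (fun N : ℕ => (∑ n ∈ Finset.range N, a n) / Real.log N) atTop (𝓝 L) := by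
  have hle1 : ∀ n, a n ≤ 1 := fun n => (ha1 n).trans (by
    rw [div_le_one (by positivity)]; linarith [(Nat.cast_nonneg n : (0 : ℝ) ≤ n)])
  have hs : ∀ s : ℝ, 1 < s → Summable fun n => a n ^ s := fun s => summable_rpow_of_le_inv ha ha1
  have hL' : Tendsto (fun ε : ℝ => ε * ∑' n, a n ^ (1 + ε)) (𝓝[>] 0) (𝓝 L) := by
    have h1 : Tendsto (fun ε : ℝ => 1 + ε) (𝓝[>] 0) (𝓝[>] 1) := by
      refine tendsto_nhdsWithin_of_tendsto_nhds_of_eventually_within _ ?_ ?_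
      · have : Tendsto (fun ε : ℝ => 1 + ε) (𝓝 0) (𝓝 (1 + 0)) :=
          (continuous_const.add continuous_id).tendsto 0
        rw [add_zero] at this
        exact this.mono_left nhdsWithin_le_nhds
      · filter_upwards [self_mem_nhdsWithin] with ε (hε : 0 < ε)
        exact Set.mem_Ioi.2 (by linarith)
    simpa only [Function.comp_def, add_sub_cancel_left] using hL.comp h1
  have hlog : Tendsto (fun N : ℕ => Real.log N) atTop atTop :=
    Real.tendsto_log_atTop.comp tendsto_natCast_atTop_atTop
  have hinv : Tendsto (fun N : ℕ => (Real.log N)⁻¹) atTop (𝓝[>] 0) :=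
    tendsto_inv_atTop_nhdsGT_zero.comp hlog
  have hmain := (tendsto_karamataMean_karamataTest ha hle1 hs hL').comp hinv
  have hdiff : ∀ᶠ N : ℕ in atTop, karamataMean a karamataTest (Real.log N)⁻¹ =
      (∑ n ∈ Finset.range N, if (N : ℝ)⁻¹ ≤ a n then a n else 0) / Real.log N := by
    filter_upwards [eventually_ge_atTop 2] with N hN
    rw [karamataMean, tsum_congr fun n => rpow_mul_karamataTest (ha n) hN, tsum_eq_sum,
      inv_mul_eq_div]
    -- For `n ≥ N`, `a n ≤ 1 / (n + 1) < 1 / N`, so the cutoff kills the tail.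
    intro n hn
    rw [Finset.mem_range, not_lt] at hn
    rw [if_neg]
    rw [not_le]
    refine (ha1 n).trans_lt ?_
    rw [one_div]
    refine inv_strictAnti₀ (by positivity) ?_
    have : (N : ℝ) ≤ n := by exact_mod_cast hn
    linarith
  -- At most `N` terms, each below `1 / N`, are discarded, so the error is at most `1 / log N`.
  have hzero : Tendsto (fun N : ℕ => (∑ n ∈ Finset.range N, a n) / Real.log N -
      karamataMean a karamataTest (Real.log N)⁻¹) atTop (𝓝 0) := by
    refine squeeze_zero_norm' ?_ (hinv.mono_right nhdsWithin_le_nhds)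
    filter_upwards [hdiff, eventually_ge_atTop 2] with N hN hN2
    have hN0 : (0 : ℝ) < N := by positivity
    have hlog : 0 < Real.log N := Real.log_pos (by exact_mod_cast hN2)
    rw [hN, ← sub_div, ← Finset.sum_sub_distrib, norm_div, Real.norm_of_nonneg hlog.le,
      ← one_div (Real.log N)]
    refine div_le_div_of_nonneg_right ?_ hlog.le
    refine (norm_sum_le _ _).trans ?_
    refine (Finset.sum_le_card_nsmul _ _ (N : ℝ)⁻¹ fun n _ => ?_).trans ?_
    · split_ifs with h
      · simp
      · rw [sub_zero, Real.norm_of_nonneg (ha n)]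
        exact (not_le.1 h).le
    · rw [Finset.card_range, nsmul_eq_mul, mul_inv_cancel₀ hN0.ne']
  simpa only [Function.comp_def, sub_add_cancel, zero_add] using hzero.add hmain

/-- Hardy–Littlewood Tauberian theorem for sequences `a_n = O(1 / n)`. -/
theorem tendsto_sum_div_log {C : ℝ} (hC : 0 < C) (ha : ∀ n, 0 ≤ a n)
    (haC : ∀ n : ℕ, a n ≤ C / (n + 1))
    {L : ℝ} (hL : Tendsto (fun s : ℝ => (s - 1) * ∑' n, a n ^ s) (𝓝[>] 1) (𝓝 L)) :
    Tendsto (fun N : ℕ => (∑ n ∈ Finset.range N, a n) / Real.log N) atTop (𝓝 L) := by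
  have h := tendsto_sum_div_log_of_le_inv (a := fun n => a n / C) (L := L / C)
    (fun n => div_nonneg (ha n) hC.le)
    (fun n => by
      rw [div_le_iff₀ hC, one_div_mul_eq_div]
      exact haC n) ?_
  · have h2 := h.mul_const C
    rw [div_mul_cancel₀ _ hC.ne'] at h2
    refine h2.congr fun N => ?_
    rw [← Finset.sum_div]
    field_simp
  -- Dividing the sequence by `C` multiplies the series by `C ^ (-s)`, hence the limit by `C⁻¹`.
  · have hc : Tendsto (fun s : ℝ => C ^ (-s)) (𝓝[>] 1) (𝓝 (C ^ (-1 : ℝ))) :=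
      ((Real.continuous_const_rpow hC.ne').comp continuous_neg).continuousWithinAt
    have h3 := hL.mul hc
    rw [Real.rpow_neg_one, ← div_eq_mul_inv] at h3
    refine h3.congr fun s => ?_
    simp only [Real.div_rpow (ha _) hC.le, tsum_div_const]
    rw [Real.rpow_neg hC.le]
    ring

end Tauberian

/-! ### Residues at simple poles. -/

section Residue

/-- At an at worst simple pole `c`, `(z - c) F(z)` tends to a limit, which is the residue. -/
theorem exists_residue_of_simple_pole {F : ℂ → ℂ} {c : ℂ} (hF : MeromorphicAt F c)
    (hord : -1 ≤ meromorphicOrderAt F c) :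
    ∃ R : ℂ, HasResidueAt F c R ∧ Tendsto (fun z => (z - c) * F z) (𝓝[≠] c) (𝓝 R) := by
  have hlin : MeromorphicAt (fun z : ℂ => z - c) c := by fun_prop
  have hnn : 0 ≤ meromorphicOrderAt ((fun z : ℂ => z - c) * F) c := by
    have h1 : meromorphicOrderAt (fun z : ℂ => z - c) c = 1 := by
      simp
    rw [meromorphicOrderAt_mul hlin hF, h1]
    cases h : meromorphicOrderAt F c with
    | top => simp
    | coe n =>
      rw [h] at hord
      have : (-1 : ℤ) ≤ n := WithTop.coe_le_coe.1 hord
      have h2 : (0 : ℤ) ≤ 1 + n := by omega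
      exact_mod_cast h2
  -- The value at `c` of the analytic extension `g` of `(z - c) F(z)` is both the limit and, by
  -- Cauchy's formula, the residue.
  obtain ⟨g, hg, hgF⟩ := ((hlin.mul hF).meromorphicOrderAt_nonneg_iff).1 hnn
  refine ⟨g c, ?_, (hg.continuousAt.tendsto.mono_left nhdsWithin_le_nhds).congr' hgF.symm⟩
  obtain ⟨δ₁, hδ₁, h₁⟩ := Metric.eventually_nhds_iff_ball.1 hg.eventually_analyticAt
  obtain ⟨δ₂, hδ₂, h₂⟩ := Metric.eventually_nhds_iff_ball.1 (eventually_nhdsWithin_iff.1 hgF)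
  filter_upwards [self_mem_nhdsWithin,
    mem_nhdsWithin_of_mem_nhds (gt_mem_nhds (lt_min hδ₁ hδ₂))] with r (hr : 0 < r) hrδ
  have hrδ₁ : r < δ₁ := hrδ.trans_le (min_le_left _ _)
  have hrδ₂ : r < δ₂ := hrδ.trans_le (min_le_right _ _)
  have han : ∀ z ∈ Metric.closedBall c r, AnalyticAt ℂ g z := fun z hz =>
    h₁ z (Metric.closedBall_subset_ball hrδ₁ hz)
  have hcongr : (∮ z in C(c, r), F z) = ∮ z in C(c, r), (z - c)⁻¹ • g z := by
    refine circleIntegral.integral_congr hr.le fun z hz => ?_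
    have hne : z ≠ c := Metric.ne_of_mem_sphere hz hr.ne'
    have := h₂ z (Metric.closedBall_subset_ball hrδ₂ (Metric.sphere_subset_closedBall hz)) hne
    simp only [Pi.mul_apply] at this
    rw [← this, smul_eq_mul, inv_mul_cancel_left₀ (sub_ne_zero.2 hne)]
  rw [hcongr, ← smul_eq_mul]
  exact Complex.two_pi_I_inv_smul_circleIntegral_sub_inv_smul_of_differentiable_on_off_countable
    Set.countable_empty (Metric.mem_ball_self hr)
    (fun z hz => (han z hz).continuousAt.continuousWithinAt)
    (fun z hz => (han z (Metric.ball_subset_closedBall hz.1)).differentiableAt)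

end Residue

/-! ### Holomorphy of generalised Dirichlet series. -/

section DirichletSeries

/-- Generalised Dirichlet series `∑ m_n ^ z` are holomorphic where they converge absolutely. -/
theorem differentiableOn_tsum_ofReal_cpow {m : ℕ → ℝ} (hm : ∀ n, 0 ≤ m n)
    (hs : ∀ s : ℝ, 1 < s → Summable fun n => m n ^ s) :
    DifferentiableOn ℂ (fun z : ℂ => ∑' n, (m n : ℂ) ^ z) {z | 1 < z.re} := by
  intro z hz
  obtain ⟨c, hc1, hcz⟩ := exists_between (show 1 < z.re from hz)
  -- On this strip `m n ^ c` dominates when `m n ≤ 1`, and `m n ^ (z.re + 1)` when `m n ≥ 1`; their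
  -- sum is a uniform majorant.
  set U : Set ℂ := {w | c < w.re} ∩ {w | w.re < z.re + 1}
  have hU : IsOpen U := (isOpen_lt continuous_const Complex.continuous_re).inter
    (isOpen_lt Complex.continuous_re continuous_const)
  have hzU : z ∈ U := ⟨hcz, show z.re < z.re + 1 by linarith⟩
  have hd : DifferentiableOn ℂ (fun z : ℂ => ∑' n, (m n : ℂ) ^ z) U := by
    refine Complex.differentiableOn_tsum_of_summable_norm
      ((hs c hc1).add (hs (z.re + 1) (by linarith))) (fun n => ?_) hU fun n w hw => ?_
    · rcases (hm n).eq_or_lt with h | h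
      · refine (differentiableOn_const (0 : ℂ)).congr fun w hw => ?_
        rw [← h, Complex.ofReal_zero, Complex.zero_cpow]
        rintro rfl
        have : c < (0 : ℂ).re := hw.1
        rw [Complex.zero_re] at this
        linarith
      · intro w _
        exact ((differentiableAt_id).const_cpow
          (Or.inl (by exact_mod_cast h.ne'))).differentiableWithinAt
    · have h1 : c < w.re := hw.1
      have h2 : w.re < z.re + 1 := hw.2
      rw [norm_ofReal_cpow (hm n) (by linarith)]
      have p1 := Real.rpow_nonneg (hm n) c
      have p2 := Real.rpow_nonneg (hm n) (z.re + 1)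
      rcases le_total (m n) 1 with h | h
      · have := Real.rpow_le_rpow_of_exponent_ge_of_imp (hm n) h h1.le
          (fun _ h' => absurd h' (by linarith))
        linarith
      · have := Real.rpow_le_rpow_of_exponent_le h h2.le
        linarith
  exact (hd.differentiableAt (hU.mem_nhds hzU)).differentiableWithinAt

end DirichletSeries

/-! ### From the zeta function to Dixmier traces. -/

section DixmierTrace

variable {H : Type*} [NormedAddCommGroup H] [InnerProductSpace ℂ H] [CompleteSpace H]

theorem sigma_eq_sum_range (x : H →L[ℂ] H) (n : ℕ) :
    sigma x n = ∑ j ∈ Finset.range n, mu x (j + 1) := by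
  rw [sigma, Finset.range_eq_Ico, Finset.sum_Ico_add' (fun j => mu x j) 0 n 1]
  rfl

theorem exists_mu_le_of_isBigO {x : H →L[ℂ] H}
    (hO : (fun n : ℕ => mu x n) =O[atTop] fun n : ℕ => (1 : ℝ) / n) :
    ∃ C > 0, ∀ n : ℕ, mu x (n + 1) ≤ C / (n + 1) := by
  obtain ⟨C, hC, h⟩ := bound_of_isBigO_nat_atTop hO
  refine ⟨C, hC, fun n => ?_⟩
  have h1 := @h (n + 1) (by positivity)
  rw [Real.norm_of_nonneg (mu_nonneg _ _), Real.norm_of_nonneg (by positivity),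
    mul_one_div] at h1
  exact_mod_cast h1

theorem mem_L1inftyPos {x : H →L[ℂ] H} (hc : IsCompactOperator x) (hx : 0 ≤ x) {C : ℝ}
    (hC : 0 < C) (hmu : ∀ n : ℕ, mu x (n + 1) ≤ C / (n + 1)) : x ∈ L1inftyPos H := by
  -- The harmonic sum is at most `1 + log n`, and `1 ≤ log n / log 2` for `n ≥ 2`.
  refine ⟨⟨hc, C * (1 / Real.log 2 + 1), ?_⟩, hx⟩
  rintro _ ⟨n, hn, rfl⟩
  have hn2 : (2 : ℝ) ≤ n := by exact_mod_cast hn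
  have hl2 : 0 < Real.log 2 := Real.log_pos one_lt_two
  have hl : Real.log 2 ≤ Real.log n := Real.log_le_log two_pos hn2
  have hln : 0 < Real.log n := hl2.trans_le hl
  have h1 : sigma x n ≤ C * (1 + Real.log n) := by
    have h2 := harmonic_le_one_add_log n
    rw [harmonic] at h2
    push_cast at h2
    rw [sigma_eq_sum_range]
    calc ∑ j ∈ Finset.range n, mu x (j + 1) ≤ ∑ j ∈ Finset.range n, C * ((j : ℝ) + 1)⁻¹ :=
          Finset.sum_le_sum fun j _ => hmu j
      _ = C * ∑ j ∈ Finset.range n, ((j : ℝ) + 1)⁻¹ := (Finset.mul_sum _ _ _).symm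
      _ ≤ C * (1 + Real.log n) := mul_le_mul_of_nonneg_left h2 hC.le
  rw [gamma, div_le_iff₀ hln]
  refine h1.trans ?_
  rw [mul_assoc]
  refine mul_le_mul_of_nonneg_left ?_ hC.le
  have : 1 ≤ 1 / Real.log 2 * Real.log n := by
    rw [one_div_mul_eq_div]
    exact (one_le_div hl2).2 hl
  linarith

theorem tendsto_mu_zero {x : H →L[ℂ] H} {C : ℝ} (hmu : ∀ n : ℕ, mu x (n + 1) ≤ C / (n + 1)) :
    Tendsto (fun n => mu x n) atTop (𝓝 0) := by
  rw [← tendsto_add_atTop_iff_nat 1]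
  refine squeeze_zero (fun n => mu_nonneg x _) hmu ?_
  have := (tendsto_one_div_add_atTop_nhds_zero_nat (𝕜 := ℝ)).const_mul C
  simpa only [mul_one_div, mul_zero] using this

theorem dixmierTrace_eq_of_tendsto {x : H →L[ℂ] H} (hx : x ∈ L1inftyPos H) {L : ℝ}
    (hL : Tendsto (fun n : ℕ => gamma x n) atTop (𝓝 L)) {ω : ℓ^∞(ℕ+, ℂ) →L[ℂ] ℂ}
    (hω : IsScalingInvariantState ω) : dixmierTrace ω x hx = (L : ℂ) := by
  refine hω.eq_lim _ _ ?_
  have h1 : Tendsto (fun n : ℕ+ => (n : ℕ) + 1) atTop atTop :=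
    tendsto_atTop_atTop.2 fun b => ⟨⟨b + 1, by omega⟩, fun n hn => by
      have : b + 1 ≤ (n : ℕ) := hn
      omega⟩
  exact (Complex.continuous_ofReal.tendsto L).comp (hL.comp h1)

/-- A limit of `(s - 1) ζ_x(s)` at `1` along real `s > 1` is real and is the limit of `γ_n(x)`. -/
theorem exists_tendsto_gamma {x : H →L[ℂ] H} (hc : IsCompactOperator x) (hx : 0 ≤ x) {C : ℝ}
    (hC : 0 < C) (hmu : ∀ n : ℕ, mu x (n + 1) ≤ C / (n + 1)) {R : ℂ}
    (hR : Tendsto (fun s : ℝ => ((s : ℂ) - 1) * zeta x s) (𝓝[>] 1) (𝓝 R)) :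
    ∃ L : ℝ, R = L ∧ Tendsto (fun n : ℕ => gamma x n) atTop (𝓝 L) := by
  have hs : ∀ s : ℝ, 1 < s → Summable fun n => mu x (n + 1) ^ s := fun s =>
    summable_rpow_of_le_inv (fun n => mu_nonneg x _) hmu
  have heq : ∀ᶠ s : ℝ in 𝓝[>] 1, ((s : ℂ) - 1) * zeta x s =
      (((s - 1) * ∑' n, mu x (n + 1) ^ s : ℝ) : ℂ) := by
    filter_upwards [self_mem_nhdsWithin] with s (h1 : 1 < s)
    rw [(isTraceClass_pow_and_zeta_eq hc hx (tendsto_mu_zero hmu) (z := s) (by simpa using h1)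
      (by simpa using hs s h1)).2]
    push_cast
    congr 1
    exact tsum_congr fun n => (Complex.ofReal_cpow (mu_nonneg x _) s).symm
  have hR' := hR.congr' heq
  have hre := (Complex.continuous_re.tendsto R).comp hR'
  have him := (Complex.continuous_im.tendsto R).comp hR'
  simp only [Function.comp_def, Complex.ofReal_re, Complex.ofReal_im] at hre him
  refine ⟨R.re, Complex.ext rfl ?_, ?_⟩
  · exact tendsto_nhds_unique him tendsto_const_nhds
  · simpa only [gamma, sigma_eq_sum_range] using!
      tendsto_sum_div_log hC (fun n => mu_nonneg x _) hmu hre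

theorem tendsto_ofReal_nhdsGT_one :
    Tendsto (fun s : ℝ => (s : ℂ)) (𝓝[>] 1) (𝓝[{z | 1 ≤ z.re} \ {1}] 1) := by
  refine tendsto_nhdsWithin_of_tendsto_nhds_of_eventually_within _ ?_ ?_
  · exact (Complex.continuous_ofReal.tendsto' 1 1 Complex.ofReal_one).mono_left nhdsWithin_le_nhds
  · filter_upwards [self_mem_nhdsWithin] with s (hs : 1 < s)
    refine ⟨hs.le, fun h => hs.ne' ?_⟩
    exact_mod_cast (Set.mem_singleton_iff.1 h)

theorem tendsto_sub_one_mul_zeta {x : H →L[ℂ] H} {F : ℂ → ℂ} {R : ℂ}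
    (hF : Set.EqOn F (zeta x) {z | 1 < z.re})
    (hR : Tendsto (fun z => (z - 1) * F z) (𝓝[{z | 1 ≤ z.re} \ {1}] 1) (𝓝 R)) :
    Tendsto (fun s : ℝ => ((s : ℂ) - 1) * zeta x s) (𝓝[>] 1) (𝓝 R) := by
  refine (hR.comp tendsto_ofReal_nhdsGT_one).congr' ?_
  filter_upwards [self_mem_nhdsWithin] with s (hs : 1 < s)
  simp only [Function.comp_apply]
  rw [hF (show 1 < (s : ℂ).re from hs)]

end DixmierTrace

end Dixmier

/-! ### The main theorem. -/

theorem mainTheorem4 {H : Type*} [NormedAddCommGroup H] [InnerProductSpace ℂ H] [CompleteSpace H]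
    [TopologicalSpace.SeparableSpace H] (hH : ¬ FiniteDimensional ℂ H)
    (x : H →L[ℂ] H) (hcompact : IsCompactOperator x) (hpos : 0 ≤ x)
    (hO : (fun n : ℕ => Dixmier.mu x n) =O[atTop] fun n : ℕ => (1 : ℝ) / n) :
    ∃ hx : x ∈ Dixmier.L1inftyPos H,
      (∀ z : ℂ, 1 < z.re → Dixmier.IsTraceClass (Dixmier.pow x z)) ∧
      DifferentiableOn ℂ (Dixmier.zeta x) {z | 1 < z.re} ∧
      (Dixmier.ExtendsToClosedHalfPlane (Dixmier.zeta x) →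
        ∃ L : ℝ, Tendsto (fun n : ℕ => Dixmier.gamma x n) atTop (𝓝 L) ∧
          Tendsto (fun s : ℝ => ((s : ℂ) - 1) * Dixmier.tr (Dixmier.pow x (s : ℂ)))
            (𝓝[>] 1) (𝓝 (L : ℂ)) ∧
          ∀ ω : ℓ^∞(ℕ+, ℂ) →L[ℂ] ℂ, Dixmier.IsScalingInvariantState ω →
            Dixmier.dixmierTrace ω x hx = (L : ℂ)) ∧
      (∀ F : ℂ → ℂ, MeromorphicOn F Set.univ → Set.EqOn F (Dixmier.zeta x) {z | 1 < z.re} →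
        -1 ≤ meromorphicOrderAt F 1 →
        ∃ L : ℝ, Dixmier.HasResidueAt F 1 (L : ℂ) ∧
          Tendsto (fun n : ℕ => Dixmier.gamma x n) atTop (𝓝 L) ∧
          Tendsto (fun s : ℝ => ((s : ℂ) - 1) * Dixmier.tr (Dixmier.pow x (s : ℂ)))
            (𝓝[>] 1) (𝓝 (L : ℂ)) ∧
          ∀ ω : ℓ^∞(ℕ+, ℂ) →L[ℂ] ℂ, Dixmier.IsScalingInvariantState ω →
            Dixmier.dixmierTrace ω x hx = (L : ℂ)) := by
  obtain ⟨C, hC, hmu⟩ := Dixmier.exists_mu_le_of_isBigO hO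
  have hx := Dixmier.mem_L1inftyPos hcompact hpos hC hmu
  have hs : ∀ s : ℝ, 1 < s → Summable fun n => Dixmier.mu x (n + 1) ^ s := fun s =>
    Dixmier.summable_rpow_of_le_inv (fun n => Dixmier.mu_nonneg x _) hmu
  have htc := fun (z : ℂ) (hz : 1 < z.re) => Dixmier.isTraceClass_pow_and_zeta_eq hcompact hpos
    (Dixmier.tendsto_mu_zero hmu) hz (hs z.re hz)
  refine ⟨hx, fun z hz => (htc z hz).1, ?_, ?_, ?_⟩
  · exact (Dixmier.differentiableOn_tsum_ofReal_cpow (fun n => Dixmier.mu_nonneg x (n + 1)) hs).congr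
      fun z hz => (htc z hz).2
  · rintro ⟨F, hF, -, R, hR⟩
    have hlim := Dixmier.tendsto_sub_one_mul_zeta hF hR
    obtain ⟨L, rfl, hL⟩ := Dixmier.exists_tendsto_gamma hcompact hpos hC hmu hlim
    exact ⟨L, hL, hlim, fun ω hω => Dixmier.dixmierTrace_eq_of_tendsto hx hL hω⟩
  · intro F hmer hF hord
    obtain ⟨R, hres, hR⟩ := Dixmier.exists_residue_of_simple_pole (hmer 1 trivial) hord
    -- The limit over a full punctured neighbourhood restricts to the closed half-plane, so part 3
    -- proceeds as part 2.
    have hlim := Dixmier.tendsto_sub_one_mul_zeta hF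
      (hR.mono_left (nhdsWithin_mono _ fun z hz => hz.2))
    obtain ⟨L, rfl, hL⟩ := Dixmier.exists_tendsto_gamma hcompact hpos hC hmu hlim
    exact ⟨L, hres, hL, hlim, fun ω hω => Dixmier.dixmierTrace_eq_of_tendsto hx hL hω⟩
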